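/- Let $p=p(n)\in[0,1]$. Let $\mathbb{H}_3(n,p)$ be the random $3$-uniform hypergraph on the vertex set $[n]$ in which each $3$-subset of $[n]$ is a hyperedge independently with probability $p$. The random triadic process is the following random graph process on $[n]$. It starts with the star $K_{1,n-1}$, whose centre is a fixed vertex $v_1$. At each step two distinct vertices $x,y$ are chosen uniformly at random, independently of the hypergraph and of the earlier choices, and $\{x,y\}$ is added as an edge if there is a vertex $z$ such that $\{x,z\}$ and $\{y,z\}$ are already edges of the current graph and $\{x,y,z\}$ is a hyperedge of $\mathbb{H}_3(n,p)$. Since the graph only grows, it is eventually constant; the final number of added edges is the number of edges of this eventual graph that are not edges of the initial star. Suppose that $p=o(n^{-1/2})$ and $p=\omega(n^{-2})$ as $n\to\infty$. Then, with high probability, the final number of added edges in the random triadic process equals $(1\pm o(1))\,\frac12 n^2p$. That is, if $X_n$ denotes this number, then for every $\varepsilon>0$, $$\lim_{n\to\infty}\mathbb{P}\Bigl[\bigl|X_n-\tfrac12 n^2p\bigr|\le\varepsilon\cdot\tfrac12 n^2p\Bigr]=1 .$$ -/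

import Mathlib

open MeasureTheory ProbabilityTheory Filter Topology Asymptotics

/-- The initial graph `K_{1,n-1}` on the vertex set `Fin n`: the vertex `0` is joined to every
other vertex, and there are no other edges. -/
def triadicStart (n : ℕ) : SimpleGraph (Fin n) where
  Adj x y := x ≠ y ∧ (x.val = 0 ∨ y.val = 0)
  symm := ⟨fun _ _ h => ⟨h.1.symm, h.2.symm⟩⟩
  loopless := ⟨fun _ h => h.1 rfl⟩

open Classical in
/-- One step of the process, with `H` the set of hyperedges, when the vertices `e.1`, `e.2` are
chosen: the edge `{e.1, e.2}` is added if some `z` is adjacent to both `e.1` and `e.2` and the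
triple `{e.1, e.2, z}` is a hyperedge; otherwise the graph does not change. -/
noncomputable def triadicStep {n : ℕ} (H : Set (Finset (Fin n))) (G : SimpleGraph (Fin n))
    (e : Fin n × Fin n) : SimpleGraph (Fin n) :=
  if ∃ z, G.Adj e.1 z ∧ G.Adj e.2 z ∧ ({e.1, e.2, z} : Finset (Fin n)) ∈ H then
    G ⊔ SimpleGraph.edge e.1 e.2
  else G

/-- The graph after `t` steps, when the hyperedges are `H` and the `i`-th chosen pair is `c i`. -/
noncomputable def triadicGraph {n : ℕ} (H : Set (Finset (Fin n))) (c : ℕ → Fin n × Fin n) :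
    ℕ → SimpleGraph (Fin n)
  | 0 => triadicStart n
  | t + 1 => triadicStep H (triadicGraph H c t) (c t)

/-- The final graph of the process: the union of the increasing sequence of graphs.
By `triadicGraph_eventually_eq_final` it is the graph at which the process stabilizes. -/
noncomputable def triadicFinal {n : ℕ} (H : Set (Finset (Fin n))) (c : ℕ → Fin n × Fin n) :
    SimpleGraph (Fin n) :=
  ⨆ t, triadicGraph H c t

theorem triadicGraph_monotone {n : ℕ} (H : Set (Finset (Fin n))) (c : ℕ → Fin n × Fin n) :
    Monotone (triadicGraph H c) := by
  refine monotone_nat_of_le_succ fun t => ?_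
  simp only [triadicGraph, triadicStep]
  split_ifs
  · exact le_sup_left
  · exact le_rfl

theorem triadicGraph_eventually_eq_final {n : ℕ} (H : Set (Finset (Fin n)))
    (c : ℕ → Fin n × Fin n) : ∃ T, ∀ t ≥ T, triadicGraph H c t = triadicFinal H c := by
  obtain ⟨T, hT⟩ := WellFoundedGT.monotone_chain_condition
    ⟨triadicGraph H c, triadicGraph_monotone H c⟩
  refine ⟨T, fun t ht => le_antisymm (le_iSup (triadicGraph H c) t) (iSup_le fun s => ?_)⟩
  have h1 : triadicGraph H c T = triadicGraph H c t := hT t ht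
  have h2 : triadicGraph H c T = triadicGraph H c (max s T) := hT _ (le_max_right s T)
  rw [← h1, h2]
  exact triadicGraph_monotone H c (le_max_left s T)

/-- The final number of added edges: the edges of the final graph that are not in the initial
graph. -/
noncomputable def triadicAdded {n : ℕ} (H : Set (Finset (Fin n))) (c : ℕ → Fin n × Fin n) : ℕ :=
  ((triadicFinal H c).edgeSet \ (triadicStart n).edgeSet).ncard

/-- The joint law, for `n ≥ 2`, of the random 3-uniform hypergraph (each 3-subset of `Fin n` is a
hyperedge independently with probability `p`) and of the sequence of choices (independent of the
hypergraph and of each other, each a uniformly random ordered pair of distinct vertices). -/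
noncomputable def triadicLaw (n : ℕ) (p : unitInterval) :
    Measure (Set (Finset (Fin n)) × (ℕ → Fin n × Fin n)) :=
  (setBernoulli {T : Finset (Fin n) | T.card = 3} p).prod
    (Measure.infinitePi fun _ : ℕ => uniformOn {e : Fin n × Fin n | e.1 ≠ e.2})

/-! Write `m = n² p`. A hyperedge through the centre has two star edges, so its third pair is
eventually added; about `m / 2` hyperedges contain the centre. The point is that hyperedges avoiding
the centre contribute only a small fraction of `m`.

Reveal the hypergraph adaptively, querying only triples that span two edges of the star together
with the pairs covered by triples already found. If exploration ends with no such triple left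
unqueried, this graph is closed under the process and contains the final graph. Each added edge then
lies in a found triple: a central one accounts for at most one edge, any other for at most three.

Exploration also halts as soon as some non-central vertex lies in more than `D` found triples, where
`D ≈ δ √n`. Until then a non-central vertex has at most `2 D` neighbours off the centre, so at most
`8 D²` non-central queries pass through it. Hence it meets at most `n + 8 D² ≤ 2 n` queries, of
which about `2 n p = o(√n)` succeed: premature halting is unlikely. This is where `p = o(n^(-1/2))`
enters. At most `8 n D²` queries are non-central, giving about `8 n p D²` successes, a small
multiple of `m` when `δ` is small.

Since queries depend on earlier answers, concentration comes from an exponential martingale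
(`sum_setBernoulli_tilt`, `setBernoulli_real_le_exp`). The errors vanish because `m → ∞`, and `√n`
beats the factor `n` from the union bound over vertices. -/

/-! ### Adaptive exploration of a random set. -/

open Classical in
/-- Adaptive exploration of a random set `H`: the queried elements after `t` steps, where the rule
`next` chooses the next query from the queried set and from its part that lies in `H`. -/
noncomputable def explore {ι : Type*} (next : Finset ι → Finset ι → Option ι) (H : Set ι) :
    ℕ → Finset ι
  | 0 => ∅
  | t + 1 =>
    (next (explore next H t) {i ∈ explore next H t | i ∈ H}).elim (explore next H t)
      fun i => insert i (explore next H t)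

open Classical in
/-- The elements of `H` found by the exploration within `t` steps. -/
noncomputable def found {ι : Type*} (next : Finset ι → Finset ι → Option ι) (H : Set ι) (t : ℕ) :
    Finset ι :=
  {i ∈ explore next H t | i ∈ H}

section Explore

variable {ι : Type*} {next : Finset ι → Finset ι → Option ι} {H H' : Set ι}

theorem mem_found {t : ℕ} {i : ι} : i ∈ found next H t ↔ i ∈ explore next H t ∧ i ∈ H := by
  simp [found]

theorem explore_succ_of_none {t : ℕ} (h : next (explore next H t) (found next H t) = none) :
    explore next H (t + 1) = explore next H t := by
  simp only [found] at h
  simp [explore, h]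

open Classical in
theorem explore_succ_of_some {t : ℕ} {i : ι}
    (h : next (explore next H t) (found next H t) = some i) :
    explore next H (t + 1) = insert i (explore next H t) := by
  simp only [found] at h
  simp [explore, h]

theorem mem_explore_succ_of_some {t : ℕ} {i j : ι}
    (h : next (explore next H t) (found next H t) = some i) :
    j ∈ explore next H (t + 1) ↔ j = i ∨ j ∈ explore next H t := by
  classical
  rw [explore_succ_of_some h, Finset.mem_insert]

theorem explore_subset_succ (t : ℕ) : explore next H t ⊆ explore next H (t + 1) := by
  classical
  cases h : next (explore next H t) (found next H t) with
  | none => rw [explore_succ_of_none h]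
  | some i => rw [explore_succ_of_some h]; exact Finset.subset_insert _ _

theorem found_subset_succ (t : ℕ) : found next H t ⊆ found next H (t + 1) := fun i hi => by
  rw [mem_found] at hi ⊢
  exact ⟨explore_subset_succ t hi.1, hi.2⟩

/-- The exploration depends only on the answers to its queries. -/
theorem explore_congr {t : ℕ} (h : ∀ i ∈ explore next H t, i ∈ H ↔ i ∈ H') :
    explore next H' t = explore next H t := by
  classical
  induction t with
  | zero => rfl
  | succ t ih =>
    have h1 : ∀ i ∈ explore next H t, i ∈ H ↔ i ∈ H' := fun i hi => h i (explore_subset_succ t hi)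
    have h2 := ih h1
    have h3 : found next H' t = found next H t := by
      ext i; rw [mem_found, mem_found, h2]
      exact and_congr_right fun hi => (h1 i hi).symm
    cases h4 : next (explore next H t) (found next H t) with
    | none => rw [explore_succ_of_none h4, explore_succ_of_none (by rw [h2, h3, h4]), h2]
    | some i => rw [explore_succ_of_some h4, explore_succ_of_some (by rw [h2, h3, h4]), h2]

theorem found_congr {t : ℕ} (h : ∀ i ∈ explore next H t, i ∈ H ↔ i ∈ H') :
    found next H' t = found next H t := by
  ext i; rw [mem_found, mem_found, explore_congr h]
  exact and_congr_right fun hi => (h i hi).symm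

/-- An exploration that never repeats a query has stopped after `Fintype.card ι` steps. -/
theorem explore_stops [Fintype ι] (hnext : ∀ Q S i, next Q S = some i → i ∉ Q) :
    next (explore next H (Fintype.card ι)) (found next H (Fintype.card ι)) = none := by
  classical
  have key : ∀ t, next (explore next H t) (found next H t) = none ∨
      t ≤ (explore next H t).card := by
    intro t
    induction t with
    | zero => right; simp
    | succ t ih =>
      cases h : next (explore next H t) (found next H t) with
      | none =>
        left
        have h2 := explore_succ_of_none h
        have h3 : found next H (t + 1) = found next H t := by simp only [found, h2]
        rw [h2, h3, h]
      | some i =>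
        right
        rw [h] at ih
        rw [explore_succ_of_some h, Finset.card_insert_of_notMem (hnext _ _ _ h)]
        simpa using ih
  rcases key (Fintype.card ι) with h | h
  · exact h
  · have hu : explore next H (Fintype.card ι) = Finset.univ :=
      Finset.eq_univ_of_card _ (le_antisymm (Finset.card_le_univ _) h)
    cases h2 : next (explore next H (Fintype.card ι)) (found next H (Fintype.card ι)) with
    | none => rfl
    | some i => exact absurd (hu ▸ Finset.mem_univ i) (hnext _ _ _ h2)

/-- An invariant of the explored set that is preserved by each query. -/
theorem explore_induction {P : Finset ι → Finset ι → Prop} (h0 : P ∅ ∅)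
    (hstep : ∀ t i, next (explore next H t) (found next H t) = some i →
      P (explore next H t) (found next H t) → P (explore next H (t + 1)) (found next H (t + 1)))
    (t : ℕ) : P (explore next H t) (found next H t) := by
  induction t with
  | zero => simpa [found, explore] using h0
  | succ t ih =>
    cases h : next (explore next H t) (found next H t) with
    | none =>
      have h2 := explore_succ_of_none h
      have h3 : found next H (t + 1) = found next H t := by simp only [found, h2]
      rwa [h2, h3]
    | some i => exact hstep t i h ih

end Explore

/-! ### Exponential tilting and a Chernoff bound for adaptive queries. -/

open Classical in
/-- The likelihood ratio of one query `i` when the probability of the elements of `A` is tilted. -/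
noncomputable def tilt {ι : Type*} (A : Finset ι) (a p : ℝ) (H : Set ι) (i : ι) : ℝ :=
  if i ∈ A then (if i ∈ H then 1 + a else 1) / (1 + a * p) else 1

-- The product is `(1 + a) ^ #found / (1 + a p) ^ #queried`, counted inside `A`, and `1 + a p ≤ exp
-- (a p)`.
open Classical in
theorem exp_le_prod_tilt {ι : Type*} [DecidableEq ι] {next : Finset ι → Finset ι → Option ι} (p : unitInterval) (A : Finset ι)
    {a : ℝ} (ha : -1 < a) (ha' : 0 < 1 + a * p) (H : Set ι) (t : ℕ) :
    Real.exp ((found next H t ∩ A).card * Real.log (1 + a) -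
      a * p * (explore next H t ∩ A).card) ≤ ∏ i ∈ explore next H t, tilt A a p H i := by
  have h1 : ∏ i ∈ explore next H t, tilt A a p H i =
      (1 + a) ^ (found next H t ∩ A).card / (1 + a * p) ^ (explore next H t ∩ A).card := by
    have h2 : found next H t ∩ A = {i ∈ explore next H t ∩ A | i ∈ H} := by
      ext i; simp [mem_found]; tauto
    have h3 : ∀ i, tilt A a p H i =
        if i ∈ A then (if i ∈ H then 1 + a else 1) / (1 + a * p) else 1 := fun i => by
      simp only [tilt]; congr
    simp only [h3]
    rw [Finset.prod_ite, Finset.prod_const_one, mul_one, Finset.filter_mem_eq_inter,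
      Finset.prod_div_distrib, Finset.prod_ite, Finset.prod_const_one, mul_one, Finset.prod_const,
      Finset.prod_const, h2]
  rw [h1, Real.exp_sub, mul_comm _ (Real.log _), Real.exp_mul, Real.exp_log (by linarith),
    Real.rpow_natCast, Real.exp_mul, Real.rpow_natCast]
  have : 1 + a * p ≤ Real.exp (a * p) := by linarith [Real.add_one_le_exp (a * (p : ℝ))]
  gcongr
  exact pow_nonneg (by linarith) _

section Tilt

variable {ι : Type*} [Fintype ι]

/-- Switching one coordinate on changes the weight by the odds `p / (1 - p)`; the cross-multiplied
form also covers `p = 1`. -/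
theorem setBernoulli_real_insert {u : Set ι} (p : unitInterval) {s : Set ι} {i : ι} (hi : i ∈ u)
    (his : i ∉ s) :
    (setBernoulli u p).real {insert i s} * (1 - p) = (setBernoulli u p).real {s} * p := by
  by_cases hs : s ⊆ u
  · have h1 : u \ s = insert i (u \ insert i s) := by
      ext j; by_cases hj : j = i
      · subst hj; simp [hi, his]
      · simp [hj]
    rw [setBernoulli_real_singleton p hs u.toFinite,
      setBernoulli_real_singleton p (Set.insert_subset hi hs) u.toFinite, h1,
      Set.ncard_insert_of_notMem his, Set.ncard_insert_of_notMem (by simp)]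
    ring
  · have hs' : ¬ insert i s ⊆ u := fun h => hs ((Set.subset_insert _ _).trans h)
    simp [measureReal_def, setBernoulli_singleton_of_not_subset p hs,
      setBernoulli_singleton_of_not_subset p hs']

-- Mean-one martingale property: which element is queried next does not depend on whether it lies in
-- `H`, and one likelihood ratio averages to `(p (1 + a) + (1 - p)) / (1 + a p) = 1`.
open Classical in
theorem sum_setBernoulli_tilt {next : Finset ι → Finset ι → Option ι} {u : Set ι}
    (hnext : ∀ Q S i, next Q S = some i → i ∉ Q ∧ i ∈ u) (p : unitInterval) (A : Finset ι) {a : ℝ}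
    (ha : 0 < 1 + a * p) (t : ℕ) :
    ∑ H : Set ι, (setBernoulli u p).real {H} * ∏ i ∈ explore next H t, tilt A a p H i = 1 := by
  induction t with
  | zero =>
    simp only [explore, Finset.prod_empty, mul_one]
    have := measureReal_biUnion_finset (μ := setBernoulli u p) (s := (Finset.univ : Finset (Set ι)))
      (f := fun H => {H}) (fun x _ y _ h => by simpa [Function.onFun] using h) (fun _ _ => .of_discrete)
    rw [← this]
    simp only [Finset.mem_univ, Set.iUnion_true, Set.iUnion_of_singleton, probReal_univ]
  | succ t ih =>
    rw [← ih, ← sub_eq_zero, ← Finset.sum_sub_distrib]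
    set nx : Set ι → Option ι := fun H => next (explore next H t) (found next H t) with hnx
    -- Changing membership of the element about to be queried alters neither the history nor the
    -- choice of that query.
    have hinv : ∀ H i, nx H = some i → ∀ H' : Set ι, (∀ j, j ≠ i → (j ∈ H ↔ j ∈ H')) →
        explore next H' t = explore next H t ∧ nx H' = some i := by
      intro H i hi H' hH
      have h1 : ∀ j ∈ explore next H t, j ∈ H ↔ j ∈ H' := fun j hj => hH j <| by
        rintro rfl; exact (hnext _ _ _ hi).1 hj
      refine ⟨explore_congr h1, ?_⟩
      simp only [hnx] at hi ⊢
      rw [explore_congr h1, found_congr h1, hi]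
    have key : ∀ H i, nx H = some i → i ∉ H →
        ((setBernoulli u p).real {H} * ∏ j ∈ explore next H (t + 1), tilt A a p H j -
          (setBernoulli u p).real {H} * ∏ j ∈ explore next H t, tilt A a p H j) +
        ((setBernoulli u p).real {insert i H} *
            ∏ j ∈ explore next (insert i H) (t + 1), tilt A a p (insert i H) j -
          (setBernoulli u p).real {insert i H} *
            ∏ j ∈ explore next (insert i H) t, tilt A a p (insert i H) j) = 0 := by
      intro H i hi hiH
      obtain ⟨h1, h2⟩ := hinv H i hi (insert i H) (fun j hj => by simp [hj])
      have hiQ := (hnext _ _ _ hi).1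
      rw [explore_succ_of_some hi, explore_succ_of_some h2, h1, Finset.prod_insert hiQ,
        Finset.prod_insert hiQ]
      have h3 : ∏ j ∈ explore next H t, tilt A a p (insert i H) j =
          ∏ j ∈ explore next H t, tilt A a p H j := by
        refine Finset.prod_congr rfl fun j hj => ?_
        have : j ≠ i := by rintro rfl; exact hiQ hj
        simp [tilt, this]
      rw [h3]
      generalize ∏ j ∈ explore next H t, tilt A a p H j = c
      have h4 := setBernoulli_real_insert p (hnext _ _ _ hi).2 hiH
      by_cases hA : i ∈ A
      · simp only [tilt, hA, hiH, if_true, if_false, Set.mem_insert_iff, true_or]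
        field_simp
        linear_combination a * c * h4
      · simp [tilt, hA]
    -- Pair `H` with the set obtained by toggling its next query. The two increments cancel by
    -- `key`; if there is no next query, the increment is zero.
    refine Finset.sum_involution
      (fun H _ => (nx H).elim H fun i => if i ∈ H then H \ {i} else insert i H) ?_ ?_ ?_ ?_
    · intro H _
      cases hi : nx H with
      | none => simp [explore_succ_of_none hi]
      | some i =>
        by_cases hiH : i ∈ H
        · have h1 := (hinv H i hi (H \ {i}) (fun j hj => by simp [hj])).2
          have := key (H \ {i}) i h1 (by simp)
          rw [Set.insert_sdiff_singleton, Set.insert_eq_of_mem hiH] at this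
          simp only [Option.elim, hiH, if_true]
          linarith
        · simp only [Option.elim, hiH, if_false]
          exact key H i hi hiH
    · intro H _ hne
      cases hi : nx H with
      | none => exact absurd (by simp [explore_succ_of_none hi]) hne
      | some i =>
        by_cases hiH : i ∈ H
        · simp only [Option.elim, hiH, if_true]
          intro h; rw [← h] at hiH; simp at hiH
        · simp only [Option.elim, hiH, if_false]
          intro h; apply hiH; rw [← h]; simp
    · simp
    · intro H _
      cases hi : nx H with
      | none => simp [hi]
      | some i =>
        by_cases hiH : i ∈ H
        · have h1 := (hinv H i hi (H \ {i}) (fun j hj => by simp [hj])).2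
          simp only [Option.elim, hiH, if_true, h1]
          simp [Set.insert_eq_of_mem hiH]
        · have h1 := (hinv H i hi (insert i H) (fun j hj => by simp [hj])).2
          simp only [Option.elim, hiH, if_false, h1]
          simp [hiH]

open Classical in
/-- Chernoff bound for adaptive exploration. -/
theorem setBernoulli_real_le_exp [DecidableEq ι] {next : Finset ι → Finset ι → Option ι} {u : Set ι}
    (hnext : ∀ Q S i, next Q S = some i → i ∉ Q ∧ i ∈ u) (p : unitInterval) (A : Finset ι) {a : ℝ}
    (ha : -1 < a) (t : ℕ) {L : ℝ} {E : Set (Set ι)}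
    (hE : ∀ H ∈ E, L ≤ (found next H t ∩ A).card * Real.log (1 + a) -
      a * p * (explore next H t ∩ A).card) :
    (setBernoulli u p).real E ≤ Real.exp (-L) := by
  have ha' : 0 < 1 + a * p := by
    rcases le_or_gt 0 a with h | h
    · have := mul_nonneg h p.2.1; linarith
    · have := p.2.2
      nlinarith [p.2.1]
  -- Exponential Markov inequality: the tilted product is at least `exp L` on `E` and has mean one.
  have h1 : (setBernoulli u p).real E * Real.exp L ≤ 1 := by
    rw [← sum_setBernoulli_tilt hnext p A ha' t]
    have h2 : (setBernoulli u p).real E = ∑ H ∈ E.toFinset, (setBernoulli u p).real {H} := by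
      rw [← measureReal_biUnion_finset (fun x _ y _ h => by simpa [Function.onFun] using h)
        (fun _ _ => .of_discrete)]
      congr 1
      ext; simp
    rw [h2, Finset.sum_mul]
    calc ∑ H ∈ E.toFinset, (setBernoulli u p).real {H} * Real.exp L
        ≤ ∑ H ∈ E.toFinset, (setBernoulli u p).real {H} *
            ∏ i ∈ explore next H t, tilt A a p H i := by
          refine Finset.sum_le_sum fun H hH => ?_
          gcongr
          exact (Real.exp_le_exp.2 (hE H (by simpa using hH))).trans
            (exp_le_prod_tilt p A ha ha' H t)
      _ ≤ _ := by
          refine Finset.sum_le_sum_of_subset_of_nonneg (Finset.subset_univ _) fun H _ _ => ?_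
          exact mul_nonneg measureReal_nonneg
            ((Real.exp_pos _).le.trans (exp_le_prod_tilt p A ha ha' H t))
  rw [Real.exp_neg, ← one_div, le_div_iff₀ (Real.exp_pos _)]
  exact h1

end Tilt

/-! ### Exploration of triples and counting of queries. -/

/-- The star together with all pairs covered by a triple of `S`. -/
def starShadow {n : ℕ} (S : Finset (Finset (Fin n))) : SimpleGraph (Fin n) where
  Adj x y := x ≠ y ∧ (x.val = 0 ∨ y.val = 0 ∨ ∃ f ∈ S, x ∈ f ∧ y ∈ f)
  symm := ⟨fun _ _ h => ⟨h.1.symm, by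
    rcases h.2 with h | h | ⟨f, hf, hx, hy⟩
    exacts [.inr (.inl h), .inl h, .inr (.inr ⟨f, hf, hy, hx⟩)]⟩⟩
  loopless := ⟨fun _ h => h.1 rfl⟩

open Classical in
/-- Every vertex other than the centre lies in at most `D` triples of `S`. -/
def SparseTriples {n : ℕ} (D : ℕ) (S : Finset (Finset (Fin n))) : Prop :=
  ∀ x : Fin n, x.val ≠ 0 → {f ∈ S | x ∈ f}.card ≤ D

/-- The triple `f` spans at least two edges of `starShadow S`. -/
def TwoEdges {n : ℕ} (S : Finset (Finset (Fin n))) (f : Finset (Fin n)) : Prop :=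
  ∃ x y z, f = {x, y, z} ∧ x ≠ y ∧ (starShadow S).Adj x z ∧ (starShadow S).Adj y z

open Classical in
/-- Query a new triple that spans two edges, as long as the triples found are sparse. -/
noncomputable def triadicNext {n : ℕ} (D : ℕ) (Q S : Finset (Finset (Fin n))) :
    Option (Finset (Fin n)) :=
  if h : SparseTriples D S ∧ ∃ f, f ∉ Q ∧ TwoEdges S f then some h.2.choose else none

section Triadic

variable {n D : ℕ} {Q S S' : Finset (Finset (Fin n))} {f : Finset (Fin n)}

theorem starShadow_mono (h : S ⊆ S') : starShadow S ≤ starShadow S' := by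
  intro x y hxy
  refine ⟨hxy.1, ?_⟩
  rcases hxy.2 with h1 | h1 | ⟨f, hf, h1⟩
  exacts [.inl h1, .inr (.inl h1), .inr (.inr ⟨f, h hf, h1⟩)]

theorem TwoEdges.mono (h : S ⊆ S') (hf : TwoEdges S f) : TwoEdges S' f := by
  obtain ⟨x, y, z, h1, h2, h3, h4⟩ := hf
  exact ⟨x, y, z, h1, h2, starShadow_mono h h3, starShadow_mono h h4⟩

theorem TwoEdges.card_eq (hf : TwoEdges S f) : f.card = 3 := by
  obtain ⟨x, y, z, rfl, h2, h3, h4⟩ := hf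
  exact Finset.card_eq_three.2 ⟨x, y, z, h2, h3.1, h4.1, rfl⟩

theorem triadicNext_eq_some (h : triadicNext D Q S = some f) :
    SparseTriples D S ∧ f ∉ Q ∧ TwoEdges S f := by
  unfold triadicNext at h
  split_ifs at h with h1
  cases h
  exact ⟨h1.1, h1.2.choose_spec⟩

theorem triadicNext_eq_none (h : triadicNext D Q S = none) (hS : SparseTriples D S)
    (hf : TwoEdges S f) : f ∈ Q := by
  unfold triadicNext at h
  split_ifs at h with h1
  by_contra h2
  exact h1 ⟨hS, f, h2, hf⟩

theorem triadicNext_valid (Q S : Finset (Finset (Fin n))) (f : Finset (Fin n))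
    (h : triadicNext D Q S = some f) : f ∉ Q ∧ f ∈ {T : Finset (Fin n) | T.card = 3} :=
  ⟨(triadicNext_eq_some h).2.1, (triadicNext_eq_some h).2.2.card_eq⟩

/-- `S'` is the set found just before the last query. The last answer may destroy sparsity, so query
counts have to refer to `S'` to hold unconditionally. -/
theorem explore_triadicNext_twoEdges (H : Set (Finset (Fin n))) (t : ℕ) :
    ∃ S' ⊆ found (triadicNext D) H t, SparseTriples D S' ∧
      ∀ f ∈ explore (triadicNext D) H t, TwoEdges S' f := by
  classical
  refine explore_induction (next := triadicNext D) (H := H)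
    (P := fun Q S => ∃ S' ⊆ S, SparseTriples D S' ∧ ∀ f ∈ Q, TwoEdges S' f)
    ⟨∅, subset_rfl, fun x _ => by simp, by simp⟩ ?_ t
  rintro t g hg ⟨S', hS', -, hQ⟩
  obtain ⟨h1, -, h3⟩ := triadicNext_eq_some hg
  refine ⟨_, found_subset_succ t, h1, fun f hf => ?_⟩
  rw [mem_explore_succ_of_some hg] at hf
  rcases hf with rfl | hf
  exacts [h3, (hQ f hf).mono hS']

open Classical in
/-- The vertices that share a triple of `S` with `x`. -/
noncomputable def tripleNeighbors (S : Finset (Finset (Fin n))) (x : Fin n) : Finset (Fin n) :=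
  {f ∈ S | x ∈ f}.biUnion fun f => f.erase x

theorem card_tripleNeighbors_le (hS : SparseTriples D S) (h3 : ∀ f ∈ S, f.card = 3) {x : Fin n}
    (hx : x.val ≠ 0) : (tripleNeighbors S x).card ≤ D * 2 := by
  classical
  refine (Finset.card_biUnion_le_card_mul _ _ 2 fun f hf => ?_).trans
    (Nat.mul_le_mul_right 2 ?_)
  · rw [Finset.mem_filter] at hf
    rw [Finset.card_erase_of_mem hf.2, h3 f hf.1]
  · convert hS x hx

theorem mem_tripleNeighbors_of_adj {x y : Fin n} (h : (starShadow S).Adj x y) (hx : x.val ≠ 0)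
    (hy : y.val ≠ 0) : y ∈ tripleNeighbors S x := by
  obtain ⟨hne, h | h | ⟨f, hf, h1, h2⟩⟩ := h
  · exact absurd h hx
  · exact absurd h hy
  · simp only [tripleNeighbors, Finset.mem_biUnion, Finset.mem_filter, Finset.mem_erase]
    exact ⟨f, ⟨hf, h1⟩, hne.symm, h2⟩

open Classical in
/-- The triples through `x` that avoid the centre and span two edges form a small set. -/
theorem card_filter_twoEdges_le (hS : SparseTriples D S) (h3 : ∀ f ∈ S, f.card = 3) {x : Fin n}
    (hx : x.val ≠ 0) :
    ({f | TwoEdges S f ∧ x ∈ f ∧ ∀ y ∈ f, y.val ≠ 0} : Finset (Finset (Fin n))).card ≤ 8 * D ^ 2 := by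
  set N : Finset (Fin n) := {y ∈ tripleNeighbors S x | y.val ≠ 0}
  -- Two edges of a triple form a path. If `x` is an end, `y` is the middle and `z` a neighbour of
  -- `y`; if `x` is the middle, both `y` and `z` are neighbours of `x`.
  set B : Finset (Finset (Fin n)) := N.biUnion fun y =>
    (tripleNeighbors S y ∪ tripleNeighbors S x).image fun z => {x, y, z}
  have hB : B.card ≤ (D * 2) * (D * 2 + D * 2) := by
    refine (Finset.card_biUnion_le_card_mul _ _ (D * 2 + D * 2) fun y hy => ?_).trans
      (Nat.mul_le_mul_right _ ((Finset.card_filter_le _ _).trans (card_tripleNeighbors_le hS h3 hx)))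
    refine Finset.card_image_le.trans ((Finset.card_union_le _ _).trans (Nat.add_le_add ?_ ?_))
    · exact card_tripleNeighbors_le hS h3 (Finset.mem_filter.1 hy).2
    · exact card_tripleNeighbors_le hS h3 hx
  refine (Finset.card_le_card fun f hf => ?_).trans (hB.trans (by ring_nf; rfl))
  simp only [Finset.mem_filter, Finset.mem_univ, true_and] at hf
  obtain ⟨⟨a, b, c, rfl, hab, hac, hbc⟩, hxf, h0⟩ := hf
  have ha : a.val ≠ 0 := h0 a (by simp)
  have hb : b.val ≠ 0 := h0 b (by simp)
  have hc : c.val ≠ 0 := h0 c (by simp)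
  simp only [B, N, Finset.mem_biUnion, Finset.mem_filter, Finset.mem_image, Finset.mem_union]
  simp only [Finset.mem_insert, Finset.mem_singleton] at hxf
  rcases hxf with rfl | rfl | rfl
  · refine ⟨c, ⟨mem_tripleNeighbors_of_adj hac ha hc, hc⟩, b,
      .inl (mem_tripleNeighbors_of_adj hbc.symm hc hb), ?_⟩
    rw [Finset.pair_comm]
  · refine ⟨c, ⟨mem_tripleNeighbors_of_adj hbc hb hc, hc⟩, a,
      .inl (mem_tripleNeighbors_of_adj hac.symm hc ha), ?_⟩
    ext; simp; tauto
  · refine ⟨a, ⟨mem_tripleNeighbors_of_adj hac.symm hc ha, ha⟩, b,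
      .inr (mem_tripleNeighbors_of_adj hbc.symm hc hb), ?_⟩
    ext; simp; tauto

open Classical in
/-- The triples that contain the centre. -/
noncomputable def centralTriples (n : ℕ) : Finset (Finset (Fin n)) :=
  {f | f.card = 3 ∧ ∃ v ∈ f, v.val = 0}

theorem mem_centralTriples : f ∈ centralTriples n ↔ f.card = 3 ∧ ∃ v ∈ f, v.val = 0 := by
  simp [centralTriples]

theorem card_centralTriples (hn : 0 < n) : (centralTriples n).card = (n - 1).choose 2 := by
  classical
  let o : Fin n := ⟨0, hn⟩
  have ho : ∀ v : Fin n, v.val = 0 → v = o := fun v hv => Fin.ext hv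
  have h1 : centralTriples n = ((Finset.univ.erase o).powersetCard 2).image (insert o) := by
    ext f
    simp only [mem_centralTriples, Finset.mem_image, Finset.mem_powersetCard]
    constructor
    · rintro ⟨h3, v, hv, h0⟩
      rw [ho v h0] at hv
      refine ⟨f.erase o, ⟨Finset.erase_subset_erase _ (Finset.subset_univ _), ?_⟩,
        Finset.insert_erase hv⟩
      rw [Finset.card_erase_of_mem hv, h3]
    · rintro ⟨g, ⟨hg, h2⟩, rfl⟩
      have hog : o ∉ g := fun h => by simpa using hg h
      exact ⟨by rw [Finset.card_insert_of_notMem hog, h2], o, by simp, rfl⟩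
  rw [h1, Finset.card_image_of_injOn, Finset.card_powersetCard, Finset.card_erase_of_mem (by simp),
    Finset.card_univ, Fintype.card_fin]
  intro g hg g' hg' h
  rw [Finset.mem_coe, Finset.mem_powersetCard] at hg hg'
  have hog : o ∉ g := fun h => by simpa using hg.1 h
  have hog' : o ∉ g' := fun h => by simpa using hg'.1 h
  rw [← Finset.erase_insert hog, ← Finset.erase_insert hog']
  exact congrArg (fun s => s.erase o) h

/-- The two star edges suffice, so central triples are eligible whatever has been found. -/
theorem twoEdges_of_mem_centralTriples (hf : f ∈ centralTriples n) : TwoEdges S f := by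
  obtain ⟨h3, v, hv, h0⟩ := mem_centralTriples.1 hf
  classical
  have h2 : (f.erase v).card = 2 := by rw [Finset.card_erase_of_mem hv, h3]
  obtain ⟨x, y, hxy, h⟩ := Finset.card_eq_two.1 h2
  have hx : x ∈ f.erase v := by rw [h]; simp
  have hy : y ∈ f.erase v := by rw [h]; simp
  refine ⟨x, y, v, ?_, hxy, ⟨(Finset.mem_erase.1 hx).1, .inr (.inl h0)⟩,
    ⟨(Finset.mem_erase.1 hy).1, .inr (.inl h0)⟩⟩
  rw [← Finset.insert_erase hv, h]
  ext; simp; tauto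

theorem card_explore_central_le (H : Set (Finset (Fin n))) (t : ℕ) :
    (explore (triadicNext D) H t ∩ centralTriples n).card ≤ (n - 1).choose 2 := by
  rcases n.eq_zero_or_pos with rfl | hn
  · refine (Finset.card_le_card Finset.inter_subset_right).trans ?_
    simp [centralTriples, Finset.eq_empty_of_isEmpty]
  · exact (Finset.card_le_card Finset.inter_subset_right).trans (card_centralTriples hn).le

theorem exists_sparse_twoEdges (H : Set (Finset (Fin n))) (t : ℕ) :
    ∃ S', SparseTriples D S' ∧ (∀ f ∈ S', f.card = 3) ∧
      ∀ f ∈ explore (triadicNext D) H t, TwoEdges S' f := by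
  obtain ⟨S', h1, h2, h3⟩ := explore_triadicNext_twoEdges (D := D) H t
  exact ⟨S', h2, fun f hf => (h3 f (mem_found.1 (h1 hf)).1).card_eq, h3⟩

-- Through `x` there are at most `n` triples containing the centre, one per third vertex; sparsity
-- bounds the others.
open Classical in
theorem card_explore_through_le (H : Set (Finset (Fin n))) (t : ℕ) {x : Fin n} (hx : x.val ≠ 0) :
    (explore (triadicNext D) H t ∩ ({f | x ∈ f} : Finset (Finset (Fin n)))).card ≤
      n + 8 * D ^ 2 := by
  obtain ⟨S', hS', h3, hQ⟩ := exists_sparse_twoEdges (D := D) H t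
  have hn : 0 < n := x.pos
  let o : Fin n := ⟨0, hn⟩
  have ho : ∀ v : Fin n, v.val = 0 → v = o := fun v hv => Fin.ext hv
  have hxo : x ≠ o := fun h => hx (by rw [h])
  have hsub : explore (triadicNext D) H t ∩ ({f | x ∈ f} : Finset (Finset (Fin n))) ⊆
      (Finset.univ.image fun y => {x, o, y}) ∪
        ({f | TwoEdges S' f ∧ x ∈ f ∧ ∀ y ∈ f, y.val ≠ 0} : Finset (Finset (Fin n))) := by
    intro f hf
    simp only [Finset.mem_inter, Finset.mem_filter, Finset.mem_univ, true_and] at hf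
    simp only [Finset.mem_union, Finset.mem_image, Finset.mem_filter, Finset.mem_univ, true_and]
    by_cases h0 : ∀ y ∈ f, y.val ≠ 0
    · exact .inr ⟨hQ f hf.1, hf.2, h0⟩
    · left
      push Not at h0
      obtain ⟨v, hv, h0⟩ := h0
      rw [ho v h0] at hv
      have h1 : ((f.erase x).erase o).card = 1 := by
        rw [Finset.card_erase_of_mem (Finset.mem_erase.2 ⟨hxo.symm, hv⟩),
          Finset.card_erase_of_mem hf.2, (hQ f hf.1).card_eq]
      obtain ⟨y, hy⟩ := Finset.card_eq_one.1 h1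
      refine ⟨y, ?_⟩
      rw [← hy, Finset.insert_erase (Finset.mem_erase.2 ⟨hxo.symm, hv⟩), Finset.insert_erase hf.2]
  refine (Finset.card_le_card hsub).trans ((Finset.card_union_le _ _).trans (Nat.add_le_add ?_ ?_))
  · exact Finset.card_image_le.trans (by simp)
  · exact card_filter_twoEdges_le hS' h3 hx

open Classical in
theorem card_explore_noncentral_le (H : Set (Finset (Fin n))) (t : ℕ) :
    (explore (triadicNext D) H t ∩ (centralTriples n)ᶜ).card ≤ n * (8 * D ^ 2) := by
  obtain ⟨S', hS', h3, hQ⟩ := exists_sparse_twoEdges (D := D) H t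
  have hsub : explore (triadicNext D) H t ∩ (centralTriples n)ᶜ ⊆
      ({x | x.val ≠ 0} : Finset (Fin n)).biUnion fun x =>
        ({f | TwoEdges S' f ∧ x ∈ f ∧ ∀ y ∈ f, y.val ≠ 0} : Finset (Finset (Fin n))) := by
    intro f hf
    simp only [Finset.mem_inter, Finset.mem_compl, mem_centralTriples, not_and, not_exists] at hf
    have h3 := (hQ f hf.1).card_eq
    have h0 : ∀ y ∈ f, y.val ≠ 0 := hf.2 h3
    obtain ⟨x, hx⟩ : f.Nonempty := Finset.card_pos.1 (by omega)
    simp only [Finset.mem_biUnion, Finset.mem_filter, Finset.mem_univ, true_and]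
    exact ⟨x, h0 x hx, hQ f hf.1, hx, h0⟩
  refine (Finset.card_le_card hsub).trans ((Finset.card_biUnion_le_card_mul _ _ (8 * D ^ 2)
    fun x hx => ?_).trans (Nat.mul_le_mul_right _ ((Finset.card_le_univ _).trans (by simp))))
  exact card_filter_twoEdges_le hS' h3 (Finset.mem_filter.1 hx).2

/-! ### Comparison of the final graph with the triples found. -/

/-- If the triples of `H` that span two edges of `starShadow S` belong to `S`, the process stays
inside `starShadow S`. -/
theorem triadicFinal_le_starShadow {H : Set (Finset (Fin n))}
    (h : ∀ f ∈ H, TwoEdges S f → f ∈ S) (c : ℕ → Fin n × Fin n) :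
    triadicFinal H c ≤ starShadow S := by
  refine iSup_le fun t => ?_
  induction t with
  | zero =>
    intro x y hxy
    exact ⟨hxy.1, hxy.2.imp_right .inl⟩
  | succ t ih =>
    simp only [triadicGraph, triadicStep]
    split_ifs with h1
    · obtain ⟨z, hxz, hyz, hH⟩ := h1
      refine sup_le ih fun x y hxy => ?_
      obtain ⟨h2, hne⟩ := (SimpleGraph.edge_adj ..).1 hxy
      have hne' : (c t).1 ≠ (c t).2 := by
        rcases h2 with ⟨rfl, rfl⟩ | ⟨rfl, rfl⟩
        exacts [hne, hne.symm]
      have hS := h _ hH ⟨_, _, z, rfl, hne', ih hxz, ih hyz⟩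
      refine ⟨hne, .inr (.inr ⟨_, hS, ?_⟩)⟩
      rcases h2 with ⟨rfl, rfl⟩ | ⟨rfl, rfl⟩ <;> simp
    · exact ih

/-- An added edge avoids the centre, and a triple has one pair avoiding the centre if it is central,
three if not. -/
theorem triadicAdded_le {H : Set (Finset (Fin n))} {c : ℕ → Fin n × Fin n}
    (h : triadicFinal H c ≤ starShadow S) (h3 : ∀ f ∈ S, f.card = 3) :
    triadicAdded H c ≤ (S ∩ centralTriples n).card + 3 * (S \ centralTriples n).card := by
  classical
  set P : Finset (Fin n) → Finset (Finset (Fin n)) := fun f =>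
    ({v ∈ f | v.val ≠ 0} : Finset (Fin n)).powersetCard 2
  set B : Finset (Finset (Fin n)) :=
    (S ∩ centralTriples n).biUnion P ∪ (S \ centralTriples n).biUnion P
  have hB : B.card ≤ (S ∩ centralTriples n).card + 3 * (S \ centralTriples n).card := by
    refine (Finset.card_union_le _ _).trans (Nat.add_le_add ?_ ?_)
    · refine (Finset.card_biUnion_le_card_mul _ _ 1 fun f hf => ?_).trans (by simp)
      obtain ⟨h3, v, hv, h0⟩ := mem_centralTriples.1 (Finset.mem_inter.1 hf).2
      have h4 : ({v ∈ f | v.val ≠ 0} : Finset (Fin n)).card ≤ 2 := by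
        have : ({v ∈ f | v.val ≠ 0} : Finset (Fin n)) ⊆ f.erase v := fun w hw => by
          rw [Finset.mem_filter] at hw
          exact Finset.mem_erase.2 ⟨fun h => hw.2 (h ▸ h0), hw.1⟩
        have := Finset.card_le_card this
        rw [Finset.card_erase_of_mem hv] at this
        omega
      rw [Finset.card_powersetCard]
      exact (Nat.choose_le_choose 2 h4).trans (by simp)
    · rw [mul_comm]
      refine Finset.card_biUnion_le_card_mul _ _ 3 fun f hf => ?_
      have h4 := Finset.card_filter_le f (fun v => v.val ≠ 0)
      rw [h3 f (Finset.mem_sdiff.1 hf).1] at h4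
      rw [Finset.card_powersetCard]
      exact (Nat.choose_le_choose 2 h4).trans (by decide)
  refine le_trans ?_ hB
  rw [triadicAdded, ← Set.ncard_coe_finset]
  refine Set.ncard_le_ncard_of_injOn Sym2.toFinset ?_ ?_ (Finset.finite_toSet _)
  · intro e he
    induction e with | _ x y
    obtain ⟨h1, h2⟩ := he
    rw [SimpleGraph.mem_edgeSet] at h1 h2
    have hx : x.val ≠ 0 := fun h => h2 ⟨h1.ne, .inl h⟩
    have hy : y.val ≠ 0 := fun h => h2 ⟨h1.ne, .inr h⟩
    obtain ⟨hne, h | h | ⟨f, hf, hxf, hyf⟩⟩ := h h1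
    · exact absurd h hx
    · exact absurd h hy
    have hP : s(x, y).toFinset ∈ P f := by
      rw [Finset.mem_powersetCard, Sym2.toFinset_mk_eq]
      refine ⟨?_, Finset.card_pair hne⟩
      intro v hv
      rw [Finset.mem_insert, Finset.mem_singleton] at hv
      rcases hv with rfl | rfl <;> simp [*]
    simp only [B, Finset.coe_union, Set.mem_union, Finset.mem_coe, Finset.mem_biUnion]
    by_cases hc : f ∈ centralTriples n
    · exact .inl ⟨f, Finset.mem_inter.2 ⟨hf, hc⟩, hP⟩
    · exact .inr ⟨f, Finset.mem_sdiff.2 ⟨hf, hc⟩, hP⟩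
  · intro e _ e' _ hee
    refine Sym2.ext fun v => ?_
    rw [← Sym2.mem_toFinset, ← Sym2.mem_toFinset]
    exact hee ▸ Iff.rfl

/-- If every pair is chosen at some step, every hyperedge through the centre adds an edge. -/
theorem le_triadicAdded {H : Set (Finset (Fin n))} {c : ℕ → Fin n × Fin n}
    (hc : ∀ e : Fin n × Fin n, e.1 ≠ e.2 → ∃ t, c t = e) (hS : ∀ f ∈ S, f ∈ H) :
    (S ∩ centralTriples n).card ≤ triadicAdded H c := by
  classical
  rcases n.eq_zero_or_pos with rfl | hn
  · simp [centralTriples, Finset.eq_empty_of_isEmpty]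
  let o : Fin n := ⟨0, hn⟩
  have ho : ∀ v : Fin n, v.val = 0 → v = o := fun v hv => Fin.ext hv
  rw [triadicAdded, ← Set.ncard_coe_finset]
  -- Adjoining the centre to an added edge recovers the central triple, so the image of this map
  -- covers the triples being counted.
  refine le_trans ?_ (Set.ncard_image_le (f := fun e : Sym2 (Fin n) => insert o e.toFinset)
    (Set.toFinite _))
  refine Set.ncard_le_ncard ?_ (Set.toFinite _)
  intro f hf
  rw [Finset.mem_coe, Finset.mem_inter] at hf
  obtain ⟨h3, v, hv, h0⟩ := mem_centralTriples.1 hf.2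
  rw [ho v h0] at hv
  have h2 : (f.erase o).card = 2 := by rw [Finset.card_erase_of_mem hv, h3]
  obtain ⟨x, y, hxy, h⟩ := Finset.card_eq_two.1 h2
  have hx : x ≠ o := (Finset.mem_erase.1 (show x ∈ f.erase o by rw [h]; simp)).1
  have hy : y ≠ o := (Finset.mem_erase.1 (show y ∈ f.erase o by rw [h]; simp)).1
  have hfe : f = {o, x, y} := by rw [← Finset.insert_erase hv, h]
  refine ⟨s(x, y), ⟨?_, ?_⟩, ?_⟩
  · obtain ⟨t, ht⟩ := hc (x, y) hxy
    refine (le_iSup (triadicGraph H c) (t + 1)) ?_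
    have hstar : triadicStart n ≤ triadicGraph H c t := triadicGraph_monotone H c (Nat.zero_le t)
    have hcond : ∃ z, (triadicGraph H c t).Adj (c t).1 z ∧ (triadicGraph H c t).Adj (c t).2 z ∧
        ({(c t).1, (c t).2, z} : Finset (Fin n)) ∈ H := by
      rw [ht]
      refine ⟨o, hstar ⟨hx, .inr rfl⟩, hstar ⟨hy, .inr rfl⟩, ?_⟩
      have : ({x, y, o} : Finset (Fin n)) = f := by rw [hfe]; ext; simp; tauto
      rw [this]
      exact hS f hf.1
    simp only [triadicGraph, triadicStep]
    rw [if_pos hcond, ht]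
    exact .inr ((SimpleGraph.edge_adj ..).2 ⟨.inl ⟨rfl, rfl⟩, hxy⟩)
  · rintro ⟨-, h | h⟩
    exacts [hx (ho _ h), hy (ho _ h)]
  · simp only [Sym2.toFinset_mk_eq, hfe]

end Triadic

/-! ### Almost surely every pair is chosen. -/

theorem isProbabilityMeasure_uniformOn_ne {n : ℕ} (hn : 2 ≤ n) :
    IsProbabilityMeasure (uniformOn {e : Fin n × Fin n | e.1 ≠ e.2}) :=
  isProbabilityMeasure_uniformOn (Set.toFinite _) ⟨(⟨0, by omega⟩, ⟨1, by omega⟩), by simp⟩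

theorem triadicLaw_le_one {n : ℕ} (hn : 2 ≤ n) (p : unitInterval)
    (E : Set (Set (Finset (Fin n)) × (ℕ → Fin n × Fin n))) : triadicLaw n p E ≤ 1 := by
  have hprob := isProbabilityMeasure_uniformOn_ne hn
  have : IsProbabilityMeasure (triadicLaw n p) := by
    unfold triadicLaw; infer_instance
  exact prob_le_one

/-- A given pair is missed by `k` independent draws with probability `r ^ k`, `r < 1`, and there are
finitely many pairs. -/
theorem triadicChoices_cover {n : ℕ} (hn : 2 ≤ n) :
    (Measure.infinitePi fun _ : ℕ => uniformOn {e : Fin n × Fin n | e.1 ≠ e.2})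
      {c | ∀ e : Fin n × Fin n, e.1 ≠ e.2 → ∃ t, c t = e} = 1 := by
  have hprob := isProbabilityMeasure_uniformOn_ne hn
  rw [← mem_ae_iff_prob_eq_one₀]
  · show ∀ᵐ c ∂_, _
    rw [ae_all_iff]
    intro e
    by_cases he : e.1 ≠ e.2
    swap
    · exact Eventually.of_forall fun c h => absurd h he
    simp only [he, ne_eq, not_false_eq_true, forall_const]
    rw [ae_iff]
    simp only [not_exists]
    set r := uniformOn {e : Fin n × Fin n | e.1 ≠ e.2} {e}ᶜ with hr
    have hr1 : r < 1 := by
      rw [hr, prob_compl_eq_one_sub (MeasurableSet.singleton e)]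
      refine ENNReal.sub_lt_self ENNReal.one_ne_top one_ne_zero fun h => ?_
      rw [uniformOn_eq_zero_iff (Set.toFinite _)] at h
      have : e ∈ ({e : Fin n × Fin n | e.1 ≠ e.2} ∩ {e}) := ⟨he, rfl⟩
      rw [h] at this
      exact this
    refine le_antisymm ?_ bot_le
    refine ge_of_tendsto' (ENNReal.tendsto_pow_atTop_nhds_zero_of_lt_one hr1) fun k => ?_
    have := Measure.infinitePi_pi (μ := fun _ : ℕ => uniformOn {e : Fin n × Fin n | e.1 ≠ e.2})
      (s := Finset.range k) (t := fun _ => {e}ᶜ) (fun _ _ => (MeasurableSet.singleton e).compl)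
    rw [Finset.prod_const, Finset.card_range, ← hr] at this
    rw [← this]
    exact measure_mono fun c hc i _ => hc i
  · refine MeasurableSet.nullMeasurableSet ?_
    have : {c : ℕ → Fin n × Fin n | ∀ e : Fin n × Fin n, e.1 ≠ e.2 → ∃ t, c t = e} =
        ⋂ e : Fin n × Fin n, ⋂ _ : e.1 ≠ e.2, ⋃ t, (fun c => c t) ⁻¹' {e} := by
      ext c; simp
    rw [this]
    exact MeasurableSet.iInter fun e => MeasurableSet.iInter fun _ => MeasurableSet.iUnion fun t =>
      measurable_pi_apply t (MeasurableSet.singleton e)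

/-! ### Tail bounds and the typical event. -/

/-- The triples found by the triadic exploration when it has stopped. -/
noncomputable def triadicFound {n : ℕ} (D : ℕ) (H : Set (Finset (Fin n))) :
    Finset (Finset (Fin n)) :=
  found (triadicNext D) H (Fintype.card (Finset (Fin n)))

section Tails

variable {n : ℕ} (D : ℕ) (p : unitInterval)

/-- A sparse final set rules out premature halting, so the exploration ended because no eligible
triple was left. -/
theorem mem_of_sparse {D : ℕ} {H : Set (Finset (Fin n))} (h : SparseTriples D (triadicFound D H))
    {f : Finset (Fin n)} (hf : TwoEdges (triadicFound D H) f) :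
    f ∈ explore (triadicNext D) H (Fintype.card (Finset (Fin n))) :=
  triadicNext_eq_none (explore_stops fun Q S i hi => (triadicNext_valid Q S i hi).1) h hf

/-- Union bound over the vertices, with tilt `a = 1` on the triples through each; at most `n + 8 D²`
of them are queried. -/
theorem measure_not_sparse_le :
    (setBernoulli {T : Finset (Fin n) | T.card = 3} p).real
      {H | ¬ SparseTriples D (triadicFound D H)} ≤
    n * Real.exp (-((D + 1) * Real.log 2 - p * (n + 8 * D ^ 2))) := by
  classical
  have hsub : {H : Set (Finset (Fin n)) | ¬ SparseTriples D (triadicFound D H)} ⊆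
      ⋃ x ∈ ({x | x.val ≠ 0} : Finset (Fin n)),
        {H | D + 1 ≤ (triadicFound D H ∩ ({f | x ∈ f} : Finset (Finset (Fin n)))).card} := by
    intro H hH
    simp only [SparseTriples, Set.mem_ofPred_eq, not_forall, not_le] at hH
    obtain ⟨x, hx, h⟩ := hH
    simp only [Set.mem_iUnion, Finset.mem_filter, Finset.mem_univ, true_and]
    refine ⟨x, hx, ?_⟩
    have : triadicFound D H ∩ ({f | x ∈ f} : Finset (Finset (Fin n))) =
        {f ∈ triadicFound D H | x ∈ f} := by ext; simp
    rw [Set.mem_ofPred_eq, this, Nat.succ_le_iff]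
    convert h
  refine (measureReal_mono hsub (measure_ne_top _ _)).trans ((measureReal_biUnion_finset_le _ _).trans ?_)
  have hcard : (({x | x.val ≠ 0} : Finset (Fin n)).card : ℝ) ≤ n := by
    exact_mod_cast (Finset.card_le_univ _).trans (by simp)
  refine (Finset.sum_le_card_nsmul _ _
    (Real.exp (-((D + 1) * Real.log 2 - p * (n + 8 * D ^ 2)))) fun x hx => ?_).trans ?_
  · refine setBernoulli_real_le_exp (next := triadicNext D) triadicNext_valid p
      ({f | x ∈ f} : Finset (Finset (Fin n))) (a := 1) (by norm_num)
      (Fintype.card (Finset (Fin n))) fun H hH => ?_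
    have h1 : ((D : ℝ) + 1) ≤
        (triadicFound D H ∩ ({f | x ∈ f} : Finset (Finset (Fin n)))).card := by exact_mod_cast hH
    have h2 : ((explore (triadicNext D) H (Fintype.card (Finset (Fin n))) ∩
        ({f | x ∈ f} : Finset (Finset (Fin n)))).card : ℝ) ≤ n + 8 * D ^ 2 := by
      have := card_explore_through_le (D := D) H (Fintype.card (Finset (Fin n)))
        (Finset.mem_filter.1 hx).2
      exact_mod_cast (by convert this)
    have h3 := mul_le_mul_of_nonneg_left h2 p.2.1
    have h4 := mul_le_mul_of_nonneg_right h1 (Real.log_nonneg one_le_two)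
    rw [one_add_one_eq_two]
    simp only [triadicFound] at h4
    linarith
  · rw [nsmul_eq_mul]
    gcongr

theorem measure_noncentral_ge_le (K : ℝ) :
    (setBernoulli {T : Finset (Fin n) | T.card = 3} p).real
      {H | K ≤ (triadicFound D H \ centralTriples n).card} ≤
    Real.exp (-(K * Real.log 2 - p * (n * (8 * D ^ 2)))) := by
  refine setBernoulli_real_le_exp (next := triadicNext D) triadicNext_valid p
      (centralTriples n)ᶜ (a := 1) (by norm_num) (Fintype.card (Finset (Fin n))) fun H hH => ?_
  rw [Set.mem_ofPred_eq, Finset.sdiff_eq_inter_compl] at hH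
  have h2 : ((explore (triadicNext D) H (Fintype.card (Finset (Fin n))) ∩
      (centralTriples n)ᶜ).card : ℝ) ≤ n * (8 * D ^ 2) := by
    have := card_explore_noncentral_le (D := D) H (Fintype.card (Finset (Fin n)))
    exact_mod_cast (by convert this)
  have h3 := mul_le_mul_of_nonneg_left h2 p.2.1
  have h4 := mul_le_mul_of_nonneg_right hH (Real.log_nonneg one_le_two)
  rw [one_add_one_eq_two]
  simp only [triadicFound] at h4
  linarith

theorem measure_central_ge_le (K : ℝ) {a : ℝ} (ha : 0 ≤ a) :
    (setBernoulli {T : Finset (Fin n) | T.card = 3} p).real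
      {H | K ≤ (triadicFound D H ∩ centralTriples n).card} ≤
    Real.exp (-(K * Real.log (1 + a) - a * p * (n ^ 2 / 2))) := by
  refine setBernoulli_real_le_exp (next := triadicNext D) triadicNext_valid p
      (centralTriples n) (a := a) (by linarith) (Fintype.card (Finset (Fin n))) fun H hH => ?_
  have h2 : ((explore (triadicNext D) H (Fintype.card (Finset (Fin n))) ∩
      (centralTriples n)).card : ℝ) ≤ n ^ 2 / 2 := by
    refine (Nat.cast_le.2 (card_explore_central_le (D := D) H _)).trans ?_
    refine (Nat.cast_le.2 (Nat.choose_le_choose 2 (Nat.sub_le n 1))).trans ?_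
    simpa using Nat.choose_le_pow_div (α := ℝ) 2 n
  have h3 := mul_le_mul_of_nonneg_left h2 (mul_nonneg ha p.2.1)
  have h4 := mul_le_mul_of_nonneg_right hH (Real.log_nonneg (by linarith : 1 ≤ 1 + a))
  simp only [triadicFound] at h4
  linarith

theorem measure_central_le_le (hn : 0 < n) (K : ℝ) {s : ℝ} (hs : 0 ≤ s) (hs1 : s < 1) :
    (setBernoulli {T : Finset (Fin n) | T.card = 3} p).real
      {H | SparseTriples D (triadicFound D H) ∧
        (triadicFound D H ∩ centralTriples n).card ≤ K} ≤
    Real.exp (-(K * Real.log (1 - s) + s * p * (n - 1).choose 2)) := by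
  refine setBernoulli_real_le_exp (next := triadicNext D) triadicNext_valid p
      (centralTriples n) (a := -s) (by linarith) (Fintype.card (Finset (Fin n))) fun H hH => ?_
  -- The lower tail needs the number of central queries from below. Sparsity, part of the event,
  -- forces all central triples to be queried.
  have h2 : explore (triadicNext D) H (Fintype.card (Finset (Fin n))) ∩ centralTriples n =
      centralTriples n :=
    Finset.inter_eq_right.2 fun f hf => mem_of_sparse hH.1 (twoEdges_of_mem_centralTriples hf)
  have h4 := mul_le_mul_of_nonpos_right hH.2 (Real.log_nonpos (by linarith) (by linarith :
    1 - s ≤ 1))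
  rw [h2, card_centralTriples hn, ← sub_eq_add_neg]
  simp only [triadicFound] at h4
  linarith

/-- On a typical hypergraph the number of added edges is determined up to a small error. -/
theorem abs_triadicAdded_sub_le {D : ℕ} {ε m : ℝ} {H : Set (Finset (Fin n))}
    {c : ℕ → Fin n × Fin n} (hc : ∀ e : Fin n × Fin n, e.1 ≠ e.2 → ∃ t, c t = e)
    (h1 : SparseTriples D (triadicFound D H))
    (h2 : (triadicFound D H \ centralTriples n).card < ε / 12 * m)
    (h3 : (triadicFound D H ∩ centralTriples n).card < (1 + ε / 2) * m / 2)
    (h4 : (1 - ε) * m / 2 < (triadicFound D H ∩ centralTriples n).card) :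
    |(triadicAdded H c : ℝ) - m / 2| ≤ ε * (m / 2) := by
  have hQ : ∀ f ∈ triadicFound D H, f.card = 3 := by
    obtain ⟨S', -, -, h⟩ := exists_sparse_twoEdges (D := D) H (Fintype.card (Finset (Fin n)))
    exact fun f hf => (h f (mem_found.1 hf).1).card_eq
  have h5 := triadicAdded_le (triadicFinal_le_starShadow (c := c)
    fun f hf h => mem_found.2 ⟨mem_of_sparse h1 h, hf⟩) hQ
  have h6 := le_triadicAdded (S := triadicFound D H) hc fun f hf => (mem_found.1 hf).2
  have h5' : (triadicAdded H c : ℝ) ≤ (triadicFound D H ∩ centralTriples n).card +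
      3 * (triadicFound D H \ centralTriples n).card := by exact_mod_cast h5
  have h6' : ((triadicFound D H ∩ centralTriples n).card : ℝ) ≤ triadicAdded H c := by
    exact_mod_cast h6
  -- Upper error: `(ε / 2) (m / 2)` from central triples plus `3 (ε / 12) m` from the others, in
  -- total `ε m / 2`.
  rw [abs_le]
  constructor <;> linarith

theorem triadicLaw_ge (hn : 2 ≤ n) {ε s : ℝ} (hs : 0 ≤ s) (hs1 : s < 1) :
    1 - ENNReal.ofReal
      (n * Real.exp (-((D + 1) * Real.log 2 - p * (n + 8 * D ^ 2))) +
        Real.exp (-(ε / 12 * (n ^ 2 * p) * Real.log 2 - p * (n * (8 * D ^ 2)))) +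
        Real.exp (-((1 + ε / 2) * (n ^ 2 * p) / 2 * Real.log (1 + s) - s * p * (n ^ 2 / 2))) +
        Real.exp (-((1 - ε) * (n ^ 2 * p) / 2 * Real.log (1 - s) + s * p * (n - 1).choose 2))) ≤
      triadicLaw n p
        {ω | |(triadicAdded ω.1 ω.2 : ℝ) - (n : ℝ) ^ 2 * (p : ℝ) / 2| ≤
            ε * ((n : ℝ) ^ 2 * (p : ℝ) / 2)} := by
  set m : ℝ := (n : ℝ) ^ 2 * (p : ℝ)
  set μ := setBernoulli {T : Finset (Fin n) | T.card = 3} p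
  set B1 : Set (Set (Finset (Fin n))) := {H | ¬ SparseTriples D (triadicFound D H)}
  set B2 : Set (Set (Finset (Fin n))) :=
    {H | ε / 12 * m ≤ (triadicFound D H \ centralTriples n).card}
  set B3 : Set (Set (Finset (Fin n))) :=
    {H | (1 + ε / 2) * m / 2 ≤ (triadicFound D H ∩ centralTriples n).card}
  set B4 : Set (Set (Finset (Fin n))) := {H | SparseTriples D (triadicFound D H) ∧
        (triadicFound D H ∩ centralTriples n).card ≤ (1 - ε) * m / 2}
  have hbad : μ.real (B1 ∪ B2 ∪ B3 ∪ B4) ≤ _ :=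
    (measureReal_union_le _ _).trans (add_le_add ((measureReal_union_le _ _).trans
      (add_le_add ((measureReal_union_le _ _).trans (add_le_add (measure_not_sparse_le D p)
        (measure_noncentral_ge_le D p (ε / 12 * m))))
          (measure_central_ge_le D p ((1 + ε / 2) * m / 2) hs)))
            (measure_central_le_le D p (by omega) ((1 - ε) * m / 2) hs hs1))
  have hgood : ((B1 ∪ B2 ∪ B3 ∪ B4)ᶜ ×ˢ
      {c | ∀ e : Fin n × Fin n, e.1 ≠ e.2 → ∃ t, c t = e}) ⊆
      {ω : Set (Finset (Fin n)) × (ℕ → Fin n × Fin n) |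
        |(triadicAdded ω.1 ω.2 : ℝ) - m / 2| ≤ ε * (m / 2)} := by
    rintro ⟨H, c⟩ ⟨hH, hc⟩
    simp only [B1, B2, B3, B4, Set.mem_compl_iff, Set.mem_union, Set.mem_ofPred_eq, not_or, not_not,
      not_and, not_le] at hH
    obtain ⟨⟨⟨h1, h2⟩, h3⟩, h4⟩ := hH
    exact abs_triadicAdded_sub_le hc h1 h2 h3 (h4 h1)
  refine le_trans ?_ (measure_mono hgood)
  have hprob := isProbabilityMeasure_uniformOn_ne hn
  rw [triadicLaw, Measure.prod_prod, triadicChoices_cover hn, mul_one,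
    prob_compl_eq_one_sub .of_discrete, ← ofReal_measureReal]
  gcongr

end Tails

/-! ### Asymptotics and choice of parameters. -/

theorem tendsto_natCast_mul_exp_neg_sqrt {c : ℝ} (hc : 0 < c) :
    Tendsto (fun n : ℕ => (n : ℝ) * Real.exp (-(c * √n))) atTop (𝓝 0) := by
  have h1 : Tendsto (fun n : ℕ => c * √(n : ℝ)) atTop atTop :=
    (Real.tendsto_sqrt_atTop.comp tendsto_natCast_atTop_atTop).const_mul_atTop hc
  have h2 := ((Real.tendsto_pow_mul_exp_neg_atTop_nhds_zero 2).comp h1).const_mul (c ^ 2)⁻¹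
  rw [mul_zero] at h2
  refine h2.congr fun n => ?_
  simp only [Function.comp, mul_pow, Real.sq_sqrt (Nat.cast_nonneg n)]
  field_simp

theorem tendsto_exp_neg_mul {f : ℕ → ℝ} (hf : Tendsto f atTop atTop) {c : ℝ} (hc : 0 < c) :
    Tendsto (fun n => Real.exp (-(c * f n))) atTop (𝓝 0) :=
  Real.tendsto_exp_neg_atTop_nhds_zero.comp (hf.const_mul_atTop hc)

theorem tendsto_sq_mul_atTop {p : ℕ → unitInterval}
    (hp : (fun n : ℕ => (n : ℝ) ^ (-2 : ℝ)) =o[atTop] fun n : ℕ => (p n : ℝ)) :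
    Tendsto (fun n : ℕ => (n : ℝ) ^ 2 * (p n : ℝ)) atTop atTop := by
  rw [tendsto_atTop]
  intro b
  have hb : 0 < max b 1 := lt_max_of_lt_right one_pos
  filter_upwards [hp.def (inv_pos.2 hb), eventually_gt_atTop 0] with n h hn
  have hn' : (0 : ℝ) < n := by exact_mod_cast hn
  rw [Real.norm_of_nonneg (by positivity), Real.norm_of_nonneg (p n).2.1, Real.rpow_neg hn'.le,
    Real.rpow_two, inv_mul_eq_div, le_div_iff₀ hb, inv_mul_eq_div, div_le_iff₀ (by positivity)] at h
  linarith [le_max_left b 1]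

theorem eventually_mul_le_sqrt {p : ℕ → unitInterval}
    (hp : (fun n : ℕ => (p n : ℝ)) =o[atTop] fun n : ℕ => (n : ℝ) ^ (-(1 / 2) : ℝ)) {η : ℝ}
    (hη : 0 < η) : ∀ᶠ n : ℕ in atTop, (p n : ℝ) * n ≤ η * √n := by
  filter_upwards [hp.def hη, eventually_gt_atTop 0] with n h hn
  have hn' : (0 : ℝ) < n := by exact_mod_cast hn
  rw [Real.norm_of_nonneg (p n).2.1, Real.norm_of_nonneg (by positivity), Real.rpow_neg hn'.le,
    ← Real.sqrt_eq_rpow] at h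
  have h1 : √(n : ℝ) * √n = n := Real.mul_self_sqrt hn'.le
  have h2 : 0 < √(n : ℝ) := Real.sqrt_pos.2 hn'
  calc (p n : ℝ) * n ≤ η * (√(n : ℝ))⁻¹ * n := by gcongr
    _ = η * √n := by nth_rewrite 2 [← h1]; field_simp

theorem triadicLaw_tendsto_one_of_le_one {p : ℕ → unitInterval}
    (hp_upper : (fun n : ℕ => (p n : ℝ)) =o[atTop] fun n : ℕ => (n : ℝ) ^ (-(1 / 2) : ℝ))
    (hp_lower : (fun n : ℕ => (n : ℝ) ^ (-2 : ℝ)) =o[atTop] fun n : ℕ => (p n : ℝ)) {ε : ℝ}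
    (hε : 0 < ε) (hε1 : ε ≤ 1) :
    Tendsto
      (fun n : ℕ => triadicLaw n (p n)
        {ω | |(triadicAdded ω.1 ω.2 : ℝ) - (n : ℝ) ^ 2 * (p n : ℝ) / 2| ≤
          ε * ((n : ℝ) ^ 2 * (p n : ℝ) / 2)})
      atTop (𝓝 1) := by
  -- The tilts are `s` for the upper tail, whose threshold is `(1 + 2 s) m / 2`, and `-s` for the
  -- lower one, with threshold `(1 - 4 s) m / 2`. Both leave a gain of order `s² m`.
  obtain ⟨s, rfl⟩ : ∃ s, ε = 4 * s := ⟨ε / 4, by ring⟩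
  have hs : 0 < s := by linarith
  -- With `D² ≤ s n / 100`, the non-central mean bound `8 p n D² ≤ 0.08 s m` stays below `(s / 3) m
  -- log 2`.
  set δ : ℝ := √s / 10 with hδ
  have hδ0 : 0 < δ := by positivity
  have hδ2 : δ ^ 2 = s / 100 := by rw [hδ, div_pow, Real.sq_sqrt hs.le]; norm_num
  have hm := tendsto_sq_mul_atTop hp_lower
  have herr := (((tendsto_natCast_mul_exp_neg_sqrt (show 0 < 2 / 5 * δ by positivity)).add
    (tendsto_exp_neg_mul hm (show 0 < s / 10 by positivity))).add
    (tendsto_exp_neg_mul hm (show 0 < s ^ 2 / 4 by positivity))).add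
    (tendsto_exp_neg_mul hm (show 0 < s ^ 2 by positivity))
  simp only [add_zero] at herr
  have hlow := ENNReal.Tendsto.sub (tendsto_const_nhds (x := (1 : ENNReal)))
    (ENNReal.tendsto_ofReal herr) (.inl ENNReal.one_ne_top)
  rw [ENNReal.ofReal_zero, tsub_zero] at hlow
  refine tendsto_of_tendsto_of_tendsto_of_le_of_le' hlow tendsto_const_nhds ?_ ?_
  -- The bound `n ≥ 3 / s` ensures `(n - 1).choose 2 ≥ (1 - s) n² / 2`, needed for the lower tail.
  · filter_upwards [eventually_mul_le_sqrt hp_upper (show 0 < δ / 10 by positivity),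
      eventually_ge_atTop 2, eventually_ge_atTop ⌈3 / s⌉₊] with n hnp hn2 hns
    refine le_trans (tsub_le_tsub_left (ENNReal.ofReal_le_ofReal ?_) 1)
      (triadicLaw_ge ⌊δ * √(n : ℝ)⌋₊ (p n) hn2 hs.le (by linarith))
    have hns' : 3 / s ≤ n := Nat.ceil_le.1 hns
    rw [div_le_iff₀ hs] at hns'
    set D := ⌊δ * √(n : ℝ)⌋₊
    have hp0 : 0 ≤ (p n : ℝ) := (p n).2.1
    have hn2' : (2 : ℝ) ≤ n := by exact_mod_cast hn2
    have hD1 : (D : ℝ) ≤ δ * √n := Nat.floor_le (by positivity)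
    have hD2 : δ * √n ≤ D + 1 := (Nat.lt_floor_add_one _).le
    have hDsq : (D : ℝ) ^ 2 ≤ s / 100 * n := by
      calc (D : ℝ) ^ 2 ≤ (δ * √n) ^ 2 := by gcongr
        _ = s / 100 * n := by rw [mul_pow, hδ2, Real.sq_sqrt (by positivity)]
    have hlog : (0.69 : ℝ) ≤ Real.log 2 := by linarith [Real.log_two_gt_d9]
    have hm0 : 0 ≤ (n : ℝ) ^ 2 * p n := by positivity
    have hchoose : (((n - 1).choose 2 : ℕ) : ℝ) = (n - 1) * (n - 2) / 2 := by
      rw [Nat.cast_choose_two, Nat.cast_sub (by omega)]; push_cast; ring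
    gcongr ?_ * Real.exp ?_ + Real.exp ?_ + Real.exp ?_ + Real.exp ?_
    · rw [neg_le_neg_iff]
      have h1 : (p n : ℝ) * (n + 8 * D ^ 2) ≤ p n * (2 * n) := by
        gcongr; nlinarith
      have h2 : δ * √n * 0.69 ≤ (D + 1) * Real.log 2 := by gcongr
      have h3 : 0 ≤ δ * √(n : ℝ) := by positivity
      linarith
    · rw [neg_le_neg_iff]
      have h1 : (p n : ℝ) * (n * (8 * D ^ 2)) ≤ p n * (n * (8 * (s / 100 * n))) := by gcongr
      have h2 : 4 * s / 12 * ((n : ℝ) ^ 2 * p n) * 0.69 ≤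
        4 * s / 12 * ((n : ℝ) ^ 2 * p n) * Real.log 2 := by gcongr
      have h3 : 0 ≤ s * ((n : ℝ) ^ 2 * p n) := by positivity
      linarith
    · rw [neg_le_neg_iff]
      have h1 : s / (1 + s) ≤ Real.log (1 + s) := by
        have := Real.one_sub_inv_le_log_of_pos (show 0 < 1 + s by linarith)
        convert this using 1; field_simp; ring
      have h2 : s + s ^ 2 / 2 ≤ (1 + 2 * s) * (s / (1 + s)) := by
        rw [← mul_div_assoc, le_div_iff₀ (by linarith)]; nlinarith [pow_pos hs 2]
      have h3 := h2.trans (mul_le_mul_of_nonneg_left h1 (by linarith))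
      have h4 := mul_le_mul_of_nonneg_left h3 hm0
      linarith
    · rw [neg_le_neg_iff]
      have hs1 : 0 < 1 - s := by linarith
      have h1 : -(s / (1 - s)) ≤ Real.log (1 - s) := by
        have := Real.one_sub_inv_le_log_of_pos hs1
        convert this using 1; field_simp; ring
      have h2 : 2 * s ^ 2 ≤ s * (1 - s) - (1 - 4 * s) * (s / (1 - s)) := by
        rw [← mul_div_assoc, le_sub_iff_add_le, ← le_sub_iff_add_le', div_le_iff₀ hs1]
        nlinarith [pow_pos hs 2, pow_pos hs 3]
      have h3 := mul_le_mul_of_nonneg_left h1 (show 0 ≤ 1 - 4 * s by linarith)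
      have h4 : 2 * s ^ 2 ≤ s * (1 - s) + (1 - 4 * s) * Real.log (1 - s) := by linarith
      have h5 := mul_le_mul_of_nonneg_left h4 hm0
      have h6 : (1 - s) * (n : ℝ) ^ 2 / 2 ≤ ((n - 1).choose 2 : ℕ) := by
        rw [hchoose]; nlinarith
      have h7 := mul_le_mul_of_nonneg_left h6 (mul_nonneg hs.le hp0)
      linarith
  · filter_upwards [eventually_ge_atTop 2] with n hn
    exact triadicLaw_le_one hn (p n) _

theorem corollary1p2 (p : ℕ → unitInterval)
    (hp_upper : (fun n : ℕ => (p n : ℝ)) =o[atTop] fun n : ℕ => (n : ℝ) ^ (-(1 / 2) : ℝ))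
    (hp_lower : (fun n : ℕ => (n : ℝ) ^ (-2 : ℝ)) =o[atTop] fun n : ℕ => (p n : ℝ)) :
    ∀ ε : ℝ, 0 < ε →
      Tendsto
        (fun n : ℕ => triadicLaw n (p n)
          {ω | |(triadicAdded ω.1 ω.2 : ℝ) - (n : ℝ) ^ 2 * (p n : ℝ) / 2| ≤
            ε * ((n : ℝ) ^ 2 * (p n : ℝ) / 2)})
        atTop (𝓝 1) := by
  intro ε hε
  -- The event grows with `ε`, so it suffices to treat `min ε 1`; `ε ≤ 1` keeps `1 - 4 s`
  -- nonnegative above.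
  have h := triadicLaw_tendsto_one_of_le_one hp_upper hp_lower (lt_min hε one_pos)
    (min_le_right ε 1)
  refine tendsto_of_tendsto_of_tendsto_of_le_of_le' h tendsto_const_nhds
    (Eventually.of_forall fun n => measure_mono fun ω hω => ?_) ?_
  · have := (p n).2.1
    rw [Set.mem_ofPred_eq] at hω ⊢
    refine hω.trans ?_
    gcongr
    exact min_le_left _ _
  · filter_upwards [eventually_ge_atTop 2] with n hn
    exact triadicLaw_le_one hn (p n) _
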